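/- For $\omega\in\mathbb{R}$ and $k\in\mathbb{Z}_{\ge 0}$ let $$\mu_k(\omega)=\int_{-1}^1 x^k e^{i\omega x}\,dx ,$$ and for $n\in\mathbb{Z}_{\ge 0}$ let $h_n(\omega)=\det\bigl(\mu_{j+k}(\omega)\bigr)_{0\le j,k\le n}$ be the determinant of the $(n+1)\times(n+1)$ Hankel matrix of these moments. Then there is no integer $n\ge 0$ and no real $\omega^*>0$ such that $h_n(\omega^*)=h_{n+2}(\omega^*)=0$. -/

import Mathlib

namespace KissingPolynomials

/-- The moment `μ_k(ω) = ∫_{-1}^{1} x^k e^{iωx} dx`. -/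
noncomputable def moment (k : ℕ) (ω : ℝ) : ℂ :=
  ∫ x in (-1 : ℝ)..1, (x : ℂ) ^ k * Complex.exp (Complex.I * (ω : ℂ) * (x : ℂ))

/-- The `(n+1) × (n+1)` Hankel matrix `H_n(ω)` with entries `μ_{j+k}(ω)`, `0 ≤ j, k ≤ n`. -/
noncomputable def hankelMatrix (n : ℕ) (ω : ℝ) : Matrix (Fin (n + 1)) (Fin (n + 1)) ℂ :=
  Matrix.of fun j k => moment ((j : ℕ) + (k : ℕ)) ω

/-- The Hankel determinant `h_n(ω) = det H_n(ω)`. -/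
noncomputable def hankelDet (n : ℕ) (ω : ℝ) : ℂ :=
  (hankelMatrix n ω).det

end KissingPolynomials

namespace KissingPolynomials

open Polynomial

/-! ### The moment functional -/

/-! Let L denote integration against e^{iωx} on [-1, 1]. A zero of h_n gives a monic u of degree
exactly n that is orthogonal to every polynomial of degree ≤ n, itself included
(`IsOrthogonal.eq_zero` excludes lower degree). Let v be the analogue for N = n + 2. Integration by
parts with the factor 1 - x² yields ladder relations (1 - x²)v' + Nxv = cu + dv and (1 - x²)(u' +
iωu) - Nxu = -iωv - du (`exists_lower_eq`, `exists_raise_eq`, `raise_coeff_eq_neg_lower_coeff`). At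
x = ±1 they give (N - d)² = iωc = (N + d)², so d = 0, and eliminating u leaves a confluent Heun
equation for v.

In the Legendre basis this equation is a three-term recurrence with diagonal N(N+1) - k(k+1) and
off-diagonal entries iω times reals of known sign. Hence the coefficients of v up to index N are i^k
r_k c_0 with r_k > 0, while row N, whose diagonal entry vanishes, forces the coefficient of index N
- 1 to be zero. So v = 0, a contradiction (`tridiagonal_solution_eq_zero`). -/

theorem intervalIntegrable_eval_mul_exp (ω : ℝ) (p : ℂ[X]) :
    IntervalIntegrable (fun x : ℝ => p.eval (x : ℂ) * Complex.exp (Complex.I * ω * x))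
      MeasureTheory.volume (-1) 1 := by
  apply Continuous.intervalIntegrable
  fun_prop

/-- The linear functional `p ↦ ∫_{-1}^{1} p(x) e^{iωx} dx` on polynomials. -/
noncomputable def momentFunctional (ω : ℝ) : ℂ[X] →ₗ[ℂ] ℂ where
  toFun p := ∫ x in (-1 : ℝ)..1, p.eval (x : ℂ) * Complex.exp (Complex.I * ω * x)
  map_add' p q := by
    simp only [eval_add, add_mul]
    exact intervalIntegral.integral_add (intervalIntegrable_eval_mul_exp ω p)
      (intervalIntegrable_eval_mul_exp ω q)
  map_smul' a p := by
    simp only [eval_smul, smul_eq_mul, mul_assoc, RingHom.id_apply]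
    rw [intervalIntegral.integral_const_mul]

theorem momentFunctional_apply (ω : ℝ) (p : ℂ[X]) : momentFunctional ω p =
    ∫ x in (-1 : ℝ)..1, p.eval (x : ℂ) * Complex.exp (Complex.I * ω * x) := rfl

theorem momentFunctional_X_pow (ω : ℝ) (k : ℕ) : momentFunctional ω (X ^ k) = moment k ω := by
  simp [momentFunctional_apply, moment]

theorem momentFunctional_C_mul (ω : ℝ) (a : ℂ) (p : ℂ[X]) :
    momentFunctional ω (C a * p) = a * momentFunctional ω p := by
  rw [← smul_eq_C_mul, map_smul, smul_eq_mul]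

/-- Integration of the total derivative of `p(x) e^{iωx}`. -/
theorem momentFunctional_derivative_add (ω : ℝ) (p : ℂ[X]) :
    momentFunctional ω (derivative p + C (Complex.I * ω) * p) =
      p.eval 1 * Complex.exp (Complex.I * ω) - p.eval (-1) * Complex.exp (-(Complex.I * ω)) := by
  have h : ∀ x ∈ Set.uIcc (-1 : ℝ) 1,
      HasDerivAt (fun x : ℝ => p.eval (x : ℂ) * Complex.exp (Complex.I * ω * x))
        ((derivative p + C (Complex.I * ω) * p).eval (x : ℂ) *
          Complex.exp (Complex.I * ω * x)) x := by
    intro x _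
    have h1 := (p.hasDerivAt (x : ℂ)).comp_ofReal
    have h2 : HasDerivAt (fun x : ℝ => Complex.exp (Complex.I * ω * x))
        (Complex.exp (Complex.I * ω * x) * (Complex.I * ω)) x := by
      have := (((hasDerivAt_id (x : ℂ)).const_mul (Complex.I * ω)).cexp).comp_ofReal
      simpa using this
    refine (h1.mul h2).congr_deriv ?_
    simp only [eval_add, eval_mul, eval_C]
    ring
  rw [momentFunctional_apply, intervalIntegral.integral_eq_sub_of_hasDerivAt h
    (intervalIntegrable_eval_mul_exp ω _)]
  simp

/-! ### Orthogonality -/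

/-- `u` is orthogonal to all polynomials of degree at most `m` for the weight `e^{iωx}`. -/
def IsOrthogonal (ω : ℝ) (m : ℕ) (u : ℂ[X]) : Prop :=
  ∀ f : ℂ[X], f.natDegree ≤ m → momentFunctional ω (u * f) = 0

theorem natDegree_X_mul_derivative_le (u : ℂ[X]) :
    (X * derivative u).natDegree ≤ u.natDegree := by
  rw [natDegree_le_iff_coeff_eq_zero]
  intro j hj
  cases j with
  | zero => omega
  | succ j => rw [coeff_X_mul, coeff_derivative, coeff_eq_zero_of_natDegree_lt hj, zero_mul]

theorem IsOrthogonal.mono {ω : ℝ} {m k : ℕ} {u : ℂ[X]} (h : IsOrthogonal ω m u) (hk : k ≤ m) :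
    IsOrthogonal ω k u := fun f hf => h f (hf.trans hk)

theorem IsOrthogonal.add {ω : ℝ} {m : ℕ} {u v : ℂ[X]} (hu : IsOrthogonal ω m u)
    (hv : IsOrthogonal ω m v) : IsOrthogonal ω m (u + v) := fun f hf => by
  rw [add_mul, map_add, hu f hf, hv f hf, add_zero]

theorem IsOrthogonal.C_mul {ω : ℝ} {m : ℕ} {u : ℂ[X]} (hu : IsOrthogonal ω m u) (a : ℂ) :
    IsOrthogonal ω m (C a * u) := fun f hf => by
  rw [mul_assoc, momentFunctional_C_mul, hu f hf, mul_zero]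

theorem exists_isOrthogonal_of_hankelDet_eq_zero {n : ℕ} {ω : ℝ} (h : hankelDet n ω = 0) :
    ∃ u : ℂ[X], u ≠ 0 ∧ u.natDegree ≤ n ∧ IsOrthogonal ω n u := by
  obtain ⟨a, ha, hMa⟩ := Matrix.exists_mulVec_eq_zero_iff.mpr h
  refine ⟨∑ j : Fin (n + 1), C (a j) * X ^ (j : ℕ), ?_, ?_, ?_⟩
  · intro h0
    apply ha
    ext i
    have := congrArg (fun p : ℂ[X] => p.coeff i) h0
    simpa [finsetSum_coeff, coeff_C_mul, coeff_X_pow, Fin.val_inj] using this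
  · exact natDegree_sum_le_of_forall_le _ _ fun j _ =>
      (natDegree_C_mul_X_pow_le _ _).trans (Nat.lt_succ_iff.mp j.2)
  · intro f hf
    rw [f.as_sum_range' (n + 1) (Nat.lt_succ_of_le hf), Finset.mul_sum, map_sum]
    refine Finset.sum_eq_zero fun k hk => ?_
    have hk' := congrFun hMa ⟨k, Finset.mem_range.mp hk⟩
    simp only [Matrix.mulVec, dotProduct, hankelMatrix, Matrix.of_apply, Pi.zero_apply] at hk'
    rw [← C_mul_X_pow_eq_monomial, mul_left_comm, momentFunctional_C_mul, Finset.sum_mul, map_sum]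
    simp only [mul_assoc, momentFunctional_C_mul, ← pow_add, momentFunctional_X_pow]
    rw [← mul_zero (f.coeff k), ← hk']
    congr 1
    refine Finset.sum_congr rfl fun j _ => ?_
    rw [mul_comm, add_comm]

/-- Integrate the derivative of (x + 1)u²e^{iωx}: the factor x + 1 kills the boundary term at -1,
and orthogonality leaves only L(xu²). -/
theorem IsOrthogonal.eval_one {ω : ℝ} {m : ℕ} {u : ℂ[X]} (h : IsOrthogonal ω m u)
    (hu : u.natDegree ≤ m) : 2 * u.eval 1 ^ 2 * Complex.exp (Complex.I * ω) =
      Complex.I * ω * momentFunctional ω (u * (X * u)) := by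
  have h1 := momentFunctional_derivative_add ω ((X + 1) * u ^ 2)
  have h2 : derivative ((X + 1) * u ^ 2) + C (Complex.I * ω) * ((X + 1) * u ^ 2) =
      u * (u + C 2 * (X * derivative u) + C 2 * derivative u + C (Complex.I * ω) * u) +
        C (Complex.I * ω) * (u * (X * u)) := by
    simp only [derivative_mul, derivative_add, derivative_X, derivative_one, derivative_pow]
    simp
    ring
  rw [h2, map_add, momentFunctional_C_mul, h] at h1
  · simp at h1
    linear_combination -h1
  · refine natDegree_add_le_of_degree_le (natDegree_add_le_of_degree_le
      (natDegree_add_le_of_degree_le hu ?_) ?_) ?_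
    · exact (natDegree_C_mul_le _ _).trans ((natDegree_X_mul_derivative_le u).trans hu)
    · exact (natDegree_C_mul_le _ _).trans ((natDegree_derivative_le u).trans (by omega))
    · exact (natDegree_C_mul_le _ _).trans hu

theorem IsOrthogonal.eval_neg_one {ω : ℝ} {m : ℕ} {u : ℂ[X]} (h : IsOrthogonal ω m u)
    (hu : u.natDegree ≤ m) : 2 * u.eval (-1) ^ 2 * Complex.exp (-(Complex.I * ω)) =
      Complex.I * ω * momentFunctional ω (u * (X * u)) := by
  have h1 := momentFunctional_derivative_add ω ((X - 1) * u ^ 2)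
  have h2 : derivative ((X - 1) * u ^ 2) + C (Complex.I * ω) * ((X - 1) * u ^ 2) =
      u * (u + C 2 * (X * derivative u) + C (-2) * derivative u + C (-(Complex.I * ω)) * u) +
        C (Complex.I * ω) * (u * (X * u)) := by
    simp only [derivative_mul, derivative_sub, derivative_X, derivative_one, derivative_pow]
    simp
    ring
  rw [h2, map_add, momentFunctional_C_mul, h] at h1
  · simp at h1
    linear_combination -h1
  · refine natDegree_add_le_of_degree_le (natDegree_add_le_of_degree_le
      (natDegree_add_le_of_degree_le hu ?_) ?_) ?_
    · exact (natDegree_C_mul_le _ _).trans ((natDegree_X_mul_derivative_le u).trans hu)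
    · exact (natDegree_C_mul_le _ _).trans ((natDegree_derivative_le u).trans (by omega))
    · exact (natDegree_C_mul_le _ _).trans hu

/-- A nonzero polynomial of degree `d` is never orthogonal to all polynomials of degree `d + 1`. -/
theorem IsOrthogonal.eq_zero {ω : ℝ} {m d : ℕ} (hd : d < m) {u : ℂ[X]}
    (h : IsOrthogonal ω m u) (hu : u.natDegree ≤ d) : u = 0 := by
  induction d generalizing u with
  | zero =>
    obtain ⟨a, rfl⟩ : ∃ a, C a = u := ⟨_, (eq_C_of_natDegree_le_zero hu).symm⟩
    have h1 := h.eval_one (hu.trans hd.le)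
    rw [h (X * C a) (by compute_degree; omega)] at h1
    simpa [Complex.exp_ne_zero] using h1
  | succ d ih =>
    have hL : momentFunctional ω (u * (X * u)) = 0 :=
      h _ ((natDegree_mul_le_of_le natDegree_X_le hu).trans (by omega))
    have h1 := h.eval_one (hu.trans hd.le)
    have h2 := h.eval_neg_one (hu.trans hd.le)
    simp [hL, Complex.exp_ne_zero] at h1 h2
    -- Since u vanishes at ±1, integration by parts has no boundary terms, so u' inherits the
    -- orthogonality in one degree less.
    have hu' : derivative u = 0 := by
      refine ih (by omega) ?_ ((natDegree_derivative_le u).trans (by omega))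
      intro f hf
      have h3 := momentFunctional_derivative_add ω (u * f)
      have h4 : derivative (u * f) + C (Complex.I * ω) * (u * f) =
          derivative u * f + u * (derivative f + C (Complex.I * ω) * f) := by
        rw [derivative_mul]; ring
      rw [h4, map_add, h, add_zero] at h3
      · simpa [h1, h2] using h3
      · exact natDegree_add_le_of_degree_le ((natDegree_derivative_le f).trans (by omega))
          ((natDegree_C_mul_le _ _).trans hf)
    rw [eq_C_of_derivative_eq_zero hu'] at h1 ⊢
    simpa using h1

theorem exists_monic_isOrthogonal_of_hankelDet_eq_zero {n : ℕ} {ω : ℝ}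
    (h : hankelDet n ω = 0) :
    ∃ u : ℂ[X], u.Monic ∧ u.natDegree = n ∧ IsOrthogonal ω n u := by
  obtain ⟨u, hu0, hun, hu⟩ := exists_isOrthogonal_of_hankelDet_eq_zero h
  have hdeg : u.natDegree = n := by
    by_contra hne
    exact hu0 (hu.eq_zero (lt_of_le_of_ne hun hne) le_rfl)
  have hl : u.leadingCoeff⁻¹ ≠ 0 := inv_ne_zero (leadingCoeff_ne_zero.mpr hu0)
  refine ⟨C u.leadingCoeff⁻¹ * u, ?_, ?_, hu.C_mul _⟩
  · rw [mul_comm]; exact monic_mul_leadingCoeff_inv hu0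
  · rw [natDegree_C_mul hl, hdeg]

theorem IsOrthogonal.apply_mul {ω : ℝ} {m : ℕ} {u f : ℂ[X]} (h : IsOrthogonal ω m u)
    (hf : f.natDegree ≤ m + 1) : momentFunctional ω (u * f) =
      f.coeff (m + 1) * momentFunctional ω (u * X ^ (m + 1)) := by
  have h1 : (f - C (f.coeff (m + 1)) * X ^ (m + 1)).natDegree ≤ m := by
    rw [natDegree_le_iff_coeff_eq_zero]
    intro j hj
    rw [coeff_sub, coeff_C_mul_X_pow]
    split_ifs with hjm
    · rw [hjm, sub_self]
    · rw [coeff_eq_zero_of_natDegree_lt (by omega), sub_zero]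
  have h2 := h _ h1
  rw [mul_sub, map_sub, mul_left_comm, momentFunctional_C_mul] at h2
  exact sub_eq_zero.mp h2

theorem IsOrthogonal.apply_X_pow_ne_zero {ω : ℝ} {n : ℕ} {u : ℂ[X]} (h : IsOrthogonal ω n u)
    (hu : u ≠ 0) (hn : u.natDegree ≤ n) : momentFunctional ω (u * X ^ (n + 1)) ≠ 0 := by
  intro h0
  refine hu (IsOrthogonal.eq_zero (ω := ω) (Nat.lt_succ_self n) (fun f hf => ?_) hn)
  rw [h.apply_mul hf, h0, mul_zero]

/-- Subtracting a multiple of u makes g orthogonal to x^{n+1} too. Pairing the remainder with u then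
kills its top coefficient, and `IsOrthogonal.eq_zero` applies. -/
theorem IsOrthogonal.exists_eq_C_mul {ω : ℝ} {n : ℕ} {u g : ℂ[X]} (h : IsOrthogonal ω n u)
    (hu : u ≠ 0) (hn : u.natDegree ≤ n) (hg : IsOrthogonal ω n g) (hgn : g.natDegree ≤ n + 1) :
    ∃ e : ℂ, g = C e * u := by
  have hκ := h.apply_X_pow_ne_zero hu hn
  set e := momentFunctional ω (g * X ^ (n + 1)) / momentFunctional ω (u * X ^ (n + 1)) with he
  refine ⟨e, sub_eq_zero.mp ?_⟩
  set r := g - C e * u with hr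
  have hrn : r.natDegree ≤ n + 1 :=
    (natDegree_sub_le_of_le hgn ((natDegree_C_mul_le _ _).trans (hn.trans n.le_succ))).trans
      (max_self _).le
  have hro : IsOrthogonal ω (n + 1) r := by
    intro f hf
    rw [hr, sub_mul, mul_assoc, map_sub, momentFunctional_C_mul, hg.apply_mul hf, h.apply_mul hf,
      he]
    field_simp
    ring
  have hlead : r.coeff (n + 1) = 0 := by
    have h1 := h.apply_mul hrn
    rw [mul_comm, hro u (hn.trans n.le_succ)] at h1
    exact (mul_eq_zero.mp h1.symm).resolve_right hκ
  refine hro.eq_zero (Nat.lt_succ_self n) ?_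
  rw [natDegree_le_iff_coeff_eq_zero]
  intro j hj
  rcases Nat.lt_or_ge (n + 1) j with hj' | hj'
  · exact coeff_eq_zero_of_natDegree_lt (hrn.trans_lt hj')
  · rwa [show j = n + 1 by omega]

/-! ### Legendre polynomials -/

/-- The Legendre polynomials, given by their three-term recurrence. -/
noncomputable def legendre : ℕ → ℂ[X]
  | 0 => 1
  | 1 => X
  | k + 2 => C ((k : ℂ) + 2)⁻¹ *
      (C (2 * (k : ℂ) + 3) * (X * legendre (k + 1)) - C ((k : ℂ) + 1) * legendre k)

theorem legendre_add_two (k : ℕ) : C ((k : ℂ) + 2) * legendre (k + 2) =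
    C (2 * (k : ℂ) + 3) * (X * legendre (k + 1)) - C ((k : ℂ) + 1) * legendre k := by
  have h : (k : ℂ) + 2 ≠ 0 := by exact_mod_cast (by omega : k + 2 ≠ 0)
  rw [legendre, ← mul_assoc, ← C_mul, mul_inv_cancel₀ h, C_1, one_mul]

theorem natDegree_legendre_le_and_coeff_ne_zero (k : ℕ) :
    (legendre k).natDegree ≤ k ∧ (legendre k).coeff k ≠ 0 := by
  induction k using Nat.twoStepInduction with
  | zero => simp [legendre]
  | one => simp [legendre]
  | more k h0 h1 =>
    have h2 : (k : ℂ) + 2 ≠ 0 := by exact_mod_cast (by omega : k + 2 ≠ 0)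
    have h3 : 2 * (k : ℂ) + 3 ≠ 0 := by exact_mod_cast (by omega : 2 * k + 3 ≠ 0)
    constructor
    · rw [legendre]
      refine (natDegree_C_mul_le _ _).trans ((natDegree_sub_le_of_le
        ((natDegree_C_mul_le _ _).trans (natDegree_mul_le_of_le natDegree_X_le h1.1))
        ((natDegree_C_mul_le _ _).trans h0.1)).trans ?_)
      omega
    · rw [legendre, coeff_C_mul, coeff_sub, coeff_C_mul, coeff_C_mul, coeff_X_mul,
        coeff_eq_zero_of_natDegree_lt (h0.1.trans_lt (by omega : k < k + 2)), mul_zero, sub_zero]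
      exact mul_ne_zero (inv_ne_zero h2) (mul_ne_zero h3 h1.2)

theorem degree_legendre (k : ℕ) : (legendre k).degree = k := by
  obtain ⟨h1, h2⟩ := natDegree_legendre_le_and_coeff_ne_zero k
  exact degree_eq_of_le_of_coeff_ne_zero (natDegree_le_iff_degree_le.mp h1) h2

/-- The Legendre polynomials form a basis. -/
noncomputable def legendreBasis : Module.Basis ℕ ℂ ℂ[X] :=
  (⟨legendre, degree_legendre⟩ : Polynomial.Sequence ℂ).basis fun k =>
    (leadingCoeff_ne_zero.mpr (Polynomial.Sequence.ne_zero _ k)).isUnit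

theorem legendreBasis_apply (k : ℕ) : legendreBasis k = legendre k :=
  Polynomial.Sequence.basis_eq_self _ _ k

/-- The two identities feed each other in the induction, so they are proved together. -/
theorem one_sub_X_sq_mul_derivative_legendre_succ (k : ℕ) :
    (1 - X ^ 2) * derivative (legendre (k + 1)) =
        C ((k : ℂ) + 1) * (legendre k - X * legendre (k + 1)) ∧
      (1 - X ^ 2) * derivative (legendre k) =
        C ((k : ℂ) + 1) * (X * legendre k - legendre (k + 1)) := by
  induction k with
  | zero =>
    constructor
    · simp [legendre]
      ring
    · simp [legendre]
  | succ k ih =>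
    obtain ⟨h1, h0⟩ := ih
    have hr := legendre_add_two k
    have h2 : (C ((k : ℂ) + 2) : ℂ[X]) ≠ 0 :=
      C_ne_zero.mpr (by exact_mod_cast (by omega : k + 2 ≠ 0))
    have hd := congrArg derivative hr
    simp only [derivative_mul, derivative_sub, derivative_C, derivative_X, zero_mul, zero_add,
      one_mul] at hd
    simp only [C_add, C_mul, C_1, map_ofNat, Nat.cast_add, Nat.cast_one, map_natCast] at *
    have h3 : (1 - X ^ 2) * derivative (legendre (k + 1)) =
        ((k : ℂ[X]) + 1 + 1) * (X * legendre (k + 1) - legendre (k + 1 + 1)) := by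
      linear_combination h1 + hr
    refine ⟨?_, h3⟩
    apply mul_left_cancel₀ h2
    linear_combination (1 - X ^ 2) * hd + (2 * (k : ℂ[X]) + 3) * X * h1 - ((k : ℂ[X]) + 1) * h0
      + ((k : ℂ[X]) + 2) * X * hr

theorem one_sub_X_sq_ne_zero : (1 - X ^ 2 : ℂ[X]) ≠ 0 := fun h => by
  have := congrArg (eval 0) h
  simp at this

theorem X_mul_legendre_succ (k : ℕ) : X * legendre (k + 1) =
    C (((k : ℂ) + 2) / (2 * k + 3)) * legendre (k + 2) +
      C (((k : ℂ) + 1) / (2 * k + 3)) * legendre k := by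
  have h3 : 2 * (k : ℂ) + 3 ≠ 0 := by exact_mod_cast (by omega : 2 * k + 3 ≠ 0)
  have hr := congrArg (C (2 * (k : ℂ) + 3)⁻¹ * ·) (legendre_add_two k)
  simp only [mul_sub, ← mul_assoc, ← C_mul, inv_mul_cancel₀ h3, C_1, one_mul] at hr
  simp only [div_eq_inv_mul]
  linear_combination -hr

/-- The Legendre differential equation. -/
theorem derivative_one_sub_X_sq_mul_derivative_legendre (k : ℕ) :
    derivative ((1 - X ^ 2) * derivative (legendre k)) =
      C (-((k : ℂ) * (k + 1))) * legendre k := by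
  cases k with
  | zero => simp [legendre]
  | succ k =>
    obtain ⟨h1, h0⟩ := one_sub_X_sq_mul_derivative_legendre_succ k
    apply mul_left_cancel₀ one_sub_X_sq_ne_zero
    have hd := congrArg derivative h1
    rw [hd]
    simp only [derivative_mul, derivative_sub, derivative_C, derivative_X, zero_mul, zero_add,
      one_mul]
    simp only [C_add, C_mul, C_1, C_neg, Nat.cast_add, Nat.cast_one, map_natCast] at *
    linear_combination ((k : ℂ[X]) + 1) * h0 - ((k : ℂ[X]) + 1) * X * h1

/-! ### Tridiagonal operators and a confluent Heun equation -/

theorem repr_tridiagonal {V : Type*} [AddCommGroup V] [Module ℂ V] (B : Module.Basis ℕ ℂ V)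
    (T : V →ₗ[ℂ] V) (a b d : ℕ → ℂ) (h0 : T (B 0) = d 0 • B 0 + a 0 • B 1)
    (h : ∀ k, T (B (k + 1)) = d (k + 1) • B (k + 1) + a (k + 1) • B (k + 2) + b k • B k)
    (q : V) :
    B.repr (T q) 0 = d 0 * B.repr q 0 + b 0 * B.repr q 1 ∧
    ∀ k, B.repr (T q) (k + 1) =
      d (k + 1) * B.repr q (k + 1) + a k * B.repr q k + b (k + 1) * B.repr q (k + 2) := by
  constructor
  · have : B.coord 0 ∘ₗ T = d 0 • B.coord 0 + b 0 • B.coord 1 := by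
      refine B.ext fun j => ?_
      rcases j with _ | j
      · simp [h0]
      · simp [h, Finsupp.single_apply]
        split_ifs <;> simp_all
    simpa using LinearMap.congr_fun this q
  · intro k
    have : B.coord (k + 1) ∘ₗ T =
        d (k + 1) • B.coord (k + 1) + a k • B.coord k + b (k + 1) • B.coord (k + 2) := by
      refine B.ext fun j => ?_
      rcases j with _ | j
      · simp [h0, Finsupp.single_apply]
        split_ifs <;> first | omega | (subst_vars; simp)
      · simp [h, Finsupp.single_apply]
        split_ifs <;> first | omega | (subst_vars; simp)
    simpa using LinearMap.congr_fun this q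

/-- With c k = i^k r_k c 0 the recurrence becomes real with all signs aligned, so no cancellation
can occur before row N. -/
theorem tridiagonal_solution_eq_zero {N : ℕ} (hN : 0 < N) {ω : ℝ} (hω : 0 < ω) (c : ℕ →₀ ℂ)
    {A B D : ℕ → ℝ} (hA : ∀ k < N, 0 < A k) (hA' : ∀ k, A k = 0 → k = N) (hB : ∀ k, 0 < B k)
    (hD : ∀ k ≤ N, 0 ≤ D k) (hD0 : 0 < D 0) (hDN : D N = 0)
    (h0 : D 0 * c 0 + Complex.I * ω * B 0 * c 1 = 0)
    (h : ∀ k, D (k + 1) * c (k + 1) + Complex.I * ω * A k * c k +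
      Complex.I * ω * B (k + 1) * c (k + 2) = 0) : c = 0 := by
  have hω' : (ω : ℂ) ≠ 0 := by exact_mod_cast hω.ne'
  have hB' : ∀ k, (B k : ℂ) ≠ 0 := fun k => by exact_mod_cast (hB k).ne'
  by_contra hc
  have hs : c.support.Nonempty := Finsupp.support_nonempty_iff.mpr hc
  have hmax : ∀ k, c.support.max' hs < k → c k = 0 := fun k hk => by
    by_contra hk'
    exact absurd (c.support.le_max' k (Finsupp.mem_support_iff.mpr hk')) (not_le.mpr hk)
  have hK : c (c.support.max' hs) ≠ 0 := Finsupp.mem_support_iff.mp (c.support.max'_mem hs)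
  generalize c.support.max' hs = K at hK hmax
  -- Row K + 1 retains only the term in `A K * c K`, so `A K = 0`.
  obtain rfl : K = N := by
    have h1 := h K
    rw [hmax (K + 1) (by omega), hmax (K + 2) (by omega)] at h1
    exact hA' _ (by simpa [hω', hK] using h1)
  obtain ⟨M, rfl⟩ : ∃ M, K = M + 1 := ⟨K - 1, by omega⟩
  have hM : c M = 0 := by
    have h1 := h M
    rw [hDN, hmax (M + 2) (by omega)] at h1
    have : (A M : ℂ) ≠ 0 := by exact_mod_cast (hA M (by omega)).ne'
    simpa [hω', this] using h1
  have key : ∀ k ≤ M, ∃ r s : ℝ, 0 < r ∧ 0 < s ∧ c k = Complex.I ^ k * r * c 0 ∧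
      c (k + 1) = Complex.I ^ (k + 1) * s * c 0 := by
    intro k
    induction k with
    | zero =>
      refine fun _ => ⟨1, D 0 / (ω * B 0), one_pos, div_pos hD0 (mul_pos hω (hB 0)), by simp, ?_⟩
      have := hB' 0
      push_cast
      field_simp
      linear_combination -Complex.I * h0 + ω * B 0 * c 1 * Complex.I_sq
    | succ k ih =>
      intro hk
      obtain ⟨r, s, hr, hs, h1, h2⟩ := ih (by omega)
      refine ⟨s, (D (k + 1) * s + ω * A k * r) / (ω * B (k + 1)), hs, ?_, h2, ?_⟩
      · have := hD (k + 1) (by omega)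
        have := hA k (by omega)
        have := hB (k + 1)
        positivity
      · have h3 := h k
        have := hB' (k + 1)
        rw [h1, h2] at h3
        push_cast
        field_simp
        linear_combination -Complex.I * h3 + (ω * B (k + 1) * c (k + 2)) * Complex.I_sq
  obtain ⟨r, s, hr, -, h1, h2⟩ := key M le_rfl
  have hr' : (r : ℂ) ≠ 0 := by exact_mod_cast hr.ne'
  rw [hM] at h1
  have hc0 : c 0 = 0 := by simpa [hr'] using h1.symm
  exact hK (by rw [h2, hc0, mul_zero])

/-- The operator `q ↦ ((1 - x²) q')' + N(N+1) q + iω ((1 - x²) q' + N x q)`. -/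
noncomputable def heunOperator (N : ℕ) (ω : ℝ) : ℂ[X] →ₗ[ℂ] ℂ[X] :=
  derivative ∘ₗ LinearMap.mulLeft ℂ (1 - X ^ 2) ∘ₗ derivative +
    ((N : ℂ) * (N + 1)) • LinearMap.id +
    (Complex.I * ω) • (LinearMap.mulLeft ℂ (1 - X ^ 2) ∘ₗ derivative +
      (N : ℂ) • LinearMap.mulLeft ℂ X)

theorem heunOperator_apply (N : ℕ) (ω : ℝ) (q : ℂ[X]) : heunOperator N ω q =
    derivative ((1 - X ^ 2) * derivative q) + C ((N : ℂ) * (N + 1)) * q +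
      C (Complex.I * ω) * ((1 - X ^ 2) * derivative q + C (N : ℂ) * (X * q)) := by
  simp only [heunOperator, LinearMap.add_apply, LinearMap.comp_apply, LinearMap.smul_apply,
    LinearMap.mulLeft_apply, LinearMap.id_apply, smul_eq_C_mul]

theorem heunOperator_legendre_zero (N : ℕ) (ω : ℝ) : heunOperator N ω (legendre 0) =
    C ((N : ℂ) * (N + 1)) * legendre 0 + C (Complex.I * ω * N) * legendre 1 := by
  simp only [heunOperator_apply, legendre, C_mul]
  simp
  ring

theorem heunOperator_legendre_succ (N : ℕ) (ω : ℝ) (k : ℕ) :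
    heunOperator N ω (legendre (k + 1)) =
      C ((N : ℂ) * (N + 1) - (k + 1) * (k + 2)) * legendre (k + 1) +
      C (Complex.I * ω * ((k + 2) * (N - (k + 1)) / (2 * k + 3))) * legendre (k + 2) +
      C (Complex.I * ω * ((k + 1) * (N + k + 2) / (2 * k + 3))) * legendre k := by
  have h3 : 2 * (k : ℂ) + 3 ≠ 0 := by exact_mod_cast (by omega : 2 * k + 3 ≠ 0)
  have h4 : (2 * (k : ℂ) + 3) * (2 * (k : ℂ) + 3)⁻¹ = 1 := mul_inv_cancel₀ h3
  have h5 := congrArg (C : ℂ → ℂ[X]) h4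
  have h1 := (one_sub_X_sq_mul_derivative_legendre_succ k).1
  have h2 := X_mul_legendre_succ k
  rw [heunOperator_apply, derivative_one_sub_X_sq_mul_derivative_legendre, h1, h2]
  simp only [div_eq_mul_inv, C_add, C_sub, C_neg, C_mul, C_1, Nat.cast_add, Nat.cast_one,
    map_natCast, map_ofNat] at *
  linear_combination (-C Complex.I * C (ω : ℂ) * ((k : ℂ[X]) + 1) * legendre k) * h5

theorem eq_zero_of_heunOperator_eq_zero {N : ℕ} (hN : 0 < N) {ω : ℝ} (hω : 0 < ω) {q : ℂ[X]}
    (h : heunOperator N ω q = 0) : q = 0 := by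
  obtain ⟨h0, h1⟩ := repr_tridiagonal legendreBasis (heunOperator N ω)
    (fun k => Complex.I * ω * ((k + 1) * (N - k) / (2 * k + 1)))
    (fun k => Complex.I * ω * ((k + 1) * (N + k + 2) / (2 * k + 3)))
    (fun k => (N : ℂ) * (N + 1) - k * (k + 1))
    (by
      simp only [legendreBasis_apply, heunOperator_legendre_zero, smul_eq_C_mul]
      simp)
    (fun k => by
      simp only [legendreBasis_apply, heunOperator_legendre_succ, smul_eq_C_mul]
      push_cast
      ring_nf) q
  rw [← legendreBasis.repr.map_eq_zero_iff]
  have hNR : (0 : ℝ) < N := by exact_mod_cast hN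
  refine tridiagonal_solution_eq_zero hN hω _
    (A := fun k => (k + 1) * (N - k) / (2 * k + 1))
    (B := fun k => (k + 1) * (N + k + 2) / (2 * k + 3))
    (D := fun k => (N : ℝ) * (N + 1) - k * (k + 1)) ?_ ?_ ?_ ?_ ?_ ?_ ?_ ?_
  · intro k hk
    have : (0 : ℝ) < N - k := sub_pos.mpr (by exact_mod_cast hk)
    positivity
  · intro k hk
    have h2 : (k : ℝ) + 1 ≠ 0 := by positivity
    have h3 : 2 * (k : ℝ) + 1 ≠ 0 := by positivity
    have h4 : (N : ℝ) - k = 0 := by simpa [h2, h3] using hk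
    exact_mod_cast (sub_eq_zero.mp h4).symm
  · intro k
    positivity
  · intro k hk
    have : (k : ℝ) ≤ N := by exact_mod_cast hk
    have : (0 : ℝ) ≤ k := by positivity
    nlinarith
  · simp only [Nat.cast_zero]
    nlinarith
  · simp
  · rw [h] at h0
    simp only [map_zero, Finsupp.zero_apply] at h0
    push_cast at h0 ⊢
    exact h0.symm
  · intro k
    have h2 := h1 k
    rw [h] at h2
    simp only [map_zero, Finsupp.zero_apply] at h2
    push_cast at h2 ⊢
    exact h2.symm

/-! ### Consecutive zeros with step two -/

theorem natDegree_one_sub_X_sq_le : (1 - X ^ 2 : ℂ[X]).natDegree ≤ 2 := by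
  compute_degree

theorem IsOrthogonal.lower {ω : ℝ} {n : ℕ} {v : ℂ[X]} (h : IsOrthogonal ω (n + 2) v) (a : ℂ) :
    IsOrthogonal ω n ((1 - X ^ 2) * derivative v + C a * (X * v)) := by
  intro f hf
  have h1 := momentFunctional_derivative_add ω ((1 - X ^ 2) * (v * f))
  have h2 : derivative ((1 - X ^ 2) * (v * f)) + C (Complex.I * ω) * ((1 - X ^ 2) * (v * f)) =
      ((1 - X ^ 2) * derivative v + C a * (X * v)) * f +
      v * (derivative ((1 - X ^ 2) * f) + C (Complex.I * ω) * ((1 - X ^ 2) * f)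
        - C a * (X * f)) := by
    simp only [derivative_mul]
    ring
  have h3 : ((1 - X ^ 2) * f).natDegree ≤ n + 2 :=
    (natDegree_mul_le_of_le natDegree_one_sub_X_sq_le hf).trans (by omega)
  rw [h2, map_add, h, add_zero] at h1
  · simpa using h1
  · refine (natDegree_sub_le_of_le (natDegree_add_le_of_degree_le
      ((natDegree_derivative_le _).trans ((Nat.sub_le _ _).trans h3))
      ((natDegree_C_mul_le _ _).trans h3)) (m := n + 2) ?_).trans (max_self _).le
    exact (natDegree_C_mul_le _ _).trans ((natDegree_mul_le_of_le natDegree_X_le hf).trans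
      (by omega))

theorem natDegree_X_mul_X_mul_derivative_sub_le {n : ℕ} {f : ℂ[X]} (hf : f.natDegree ≤ n) :
    (X * (X * derivative f - C (n : ℂ) * f)).natDegree ≤ n := by
  rw [natDegree_le_iff_coeff_eq_zero]
  intro j hj
  obtain ⟨j, rfl⟩ : ∃ i, j = i + 1 := ⟨j - 1, by omega⟩
  rw [coeff_X_mul, coeff_sub, coeff_C_mul]
  rcases (by omega : j = n ∨ n < j) with rfl | hj'
  · cases j with
    | zero => simp
    | succ j => rw [coeff_X_mul, coeff_derivative]; push_cast; ring
  · rw [coeff_eq_zero_of_natDegree_lt (hf.trans_lt hj'), coeff_eq_zero_of_natDegree_lt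
      ((natDegree_X_mul_derivative_le f).trans_lt (hf.trans_lt hj')), mul_zero, sub_zero]

/-- The constant n + 2 makes the x^{n+1} terms cancel in the polynomial paired with u after
integration by parts. -/
theorem IsOrthogonal.raise {ω : ℝ} {n : ℕ} {u : ℂ[X]} (h : IsOrthogonal ω n u) :
    IsOrthogonal ω n ((1 - X ^ 2) * (derivative u + C (Complex.I * ω) * u) -
      C ((n : ℂ) + 2) * (X * u)) := by
  intro f hf
  have h1 := momentFunctional_derivative_add ω ((1 - X ^ 2) * (u * f))
  have h2 : derivative ((1 - X ^ 2) * (u * f)) + C (Complex.I * ω) * ((1 - X ^ 2) * (u * f)) =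
      ((1 - X ^ 2) * (derivative u + C (Complex.I * ω) * u) - C ((n : ℂ) + 2) * (X * u)) * f +
      u * (derivative f - X * (X * derivative f - C (n : ℂ) * f)) := by
    simp only [derivative_mul, derivative_sub, derivative_one, derivative_X_pow, C_add, map_ofNat,
      map_natCast]
    simp
    ring
  rw [h2, map_add, h (_ - _), add_zero] at h1
  · simpa using h1
  · exact (natDegree_sub_le_of_le ((natDegree_derivative_le f).trans ((Nat.sub_le _ _).trans hf))
      (natDegree_X_mul_X_mul_derivative_sub_le hf)).trans (max_self _).le

theorem natDegree_lower_le {n : ℕ} {v : ℂ[X]} (hv : v.natDegree ≤ n) :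
    ((1 - X ^ 2) * derivative v + C (n : ℂ) * (X * v)).natDegree ≤ n := by
  have h : (1 - X ^ 2) * derivative v + C (n : ℂ) * (X * v) =
      derivative v - X * (X * derivative v - C (n : ℂ) * v) := by ring
  rw [h]
  exact (natDegree_sub_le_of_le ((natDegree_derivative_le v).trans ((Nat.sub_le _ _).trans hv))
    (natDegree_X_mul_X_mul_derivative_sub_le hv)).trans (max_self _).le

theorem natDegree_sub_C_coeff_mul_le {d : ℕ} {f v : ℂ[X]} (hf : f.natDegree ≤ d + 1)
    (hv : v.Monic) (hvd : v.natDegree = d + 1) :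
    (f - C (f.coeff (d + 1)) * v).natDegree ≤ d := by
  rw [natDegree_le_iff_coeff_eq_zero]
  intro j hj
  rw [coeff_sub, coeff_C_mul]
  rcases (by omega : j = d + 1 ∨ d + 1 < j) with rfl | hj'
  · rw [← hvd, hv.coeff_natDegree, mul_one, sub_self]
  · rw [coeff_eq_zero_of_natDegree_lt (hf.trans_lt hj'), coeff_eq_zero_of_natDegree_lt
      (hvd.trans_lt hj'), mul_zero, sub_zero]

theorem exists_lower_eq {ω : ℝ} {n : ℕ} {u v : ℂ[X]} (hu : IsOrthogonal ω n u) (hum : u.Monic)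
    (hud : u.natDegree = n) (hv : IsOrthogonal ω (n + 2) v) (hvm : v.Monic)
    (hvd : v.natDegree = n + 2) :
    ∃ c d : ℂ, (1 - X ^ 2) * derivative v + C ((n : ℂ) + 2) * (X * v) = C c * u + C d * v := by
  set F := (1 - X ^ 2) * derivative v + C ((n : ℂ) + 2) * (X * v) with hF
  have hFd : F.natDegree ≤ n + 2 := by
    have := natDegree_lower_le hvd.le
    push_cast at this
    exact this
  obtain ⟨c, hc⟩ := hu.exists_eq_C_mul hum.ne_zero hud.le
    (g := F + C (-F.coeff (n + 2)) * v)
    ((hv.lower _).add ((hv.mono (by omega)).C_mul _))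
    (by
      have := natDegree_sub_C_coeff_mul_le hFd hvm hvd
      rwa [sub_eq_add_neg, ← neg_mul, ← C_neg] at this)
  refine ⟨c, F.coeff (n + 2), ?_⟩
  rw [C_neg] at hc
  linear_combination hc

theorem exists_raise_eq {ω : ℝ} {n : ℕ} {u v : ℂ[X]} (hu : IsOrthogonal ω n u) (hum : u.Monic)
    (hud : u.natDegree = n) (hv : IsOrthogonal ω (n + 2) v) (hvm : v.Monic)
    (hvd : v.natDegree = n + 2) :
    ∃ e : ℂ, (1 - X ^ 2) * (derivative u + C (Complex.I * ω) * u) - C ((n : ℂ) + 2) * (X * u) =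
      C (-(Complex.I * ω)) * v + C e * u := by
  have h2 : (X ^ 2 * u - C ((X ^ 2 * u).coeff (n + 2)) * v).natDegree ≤ n + 1 :=
    natDegree_sub_C_coeff_mul_le
      ((natDegree_mul_le_of_le (natDegree_X_pow_le 2) hud.le).trans (by omega)) hvm hvd
  rw [coeff_X_pow_mul, ← hud, hum.coeff_natDegree, C_1, one_mul, hud] at h2
  obtain ⟨e, he⟩ := hu.exists_eq_C_mul hum.ne_zero hud.le
    -- Adding iωv cancels the leading term -iωx^{n+2}, leaving degree at most n + 1.
    (hu.raise.add ((hv.mono (by omega : n ≤ n + 2)).C_mul (Complex.I * ω))) (by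
      have h1 : (1 - X ^ 2) * (derivative u + C (Complex.I * ω) * u) - C ((n : ℂ) + 2) * (X * u) +
          C (Complex.I * ω) * v =
          derivative u + C (Complex.I * ω) * u - X * (X * derivative u) - C ((n : ℂ) + 2) * (X * u)
            - C (Complex.I * ω) * (X ^ 2 * u - v) := by ring
      have h3 : (X * (X * derivative u)).natDegree ≤ n + 1 :=
        (natDegree_mul_le_of_le natDegree_X_le (natDegree_X_mul_derivative_le u)).trans (by omega)
      have h4 : (C ((n : ℂ) + 2) * (X * u)).natDegree ≤ n + 1 :=
        (natDegree_C_mul_le _ _).trans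
          ((natDegree_mul_le_of_le natDegree_X_le hud.le).trans (by omega))
      have h5 : (C (Complex.I * ω) * (X ^ 2 * u - v)).natDegree ≤ n + 1 :=
        (natDegree_C_mul_le _ _).trans h2
      have h6 : (derivative u + C (Complex.I * ω) * u).natDegree ≤ n + 1 :=
        natDegree_add_le_of_degree_le ((natDegree_derivative_le u).trans (by omega))
          ((natDegree_C_mul_le _ _).trans (by omega))
      rw [h1]
      exact (natDegree_sub_le_of_le ((natDegree_sub_le_of_le ((natDegree_sub_le_of_le h6 h3)) h4))
        h5).trans (by simp))
  refine ⟨e, ?_⟩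
  rw [C_neg]
  linear_combination he

/-- Integrating the derivative of (1 - x²)uv'e^{iωx} gives (e + d)L(uv') = 0, and L(uv') ≠ 0 because
v' has degree exactly n + 1. -/
theorem raise_coeff_eq_neg_lower_coeff {ω : ℝ} {n : ℕ} {u v : ℂ[X]} (hu : IsOrthogonal ω n u)
    (hu0 : u ≠ 0) (hud : u.natDegree ≤ n) (hv : IsOrthogonal ω (n + 2) v) (hvm : v.Monic)
    (hvd : v.natDegree = n + 2) {c d e : ℂ}
    (hF : (1 - X ^ 2) * derivative v + C ((n : ℂ) + 2) * (X * v) = C c * u + C d * v)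
    (hG : (1 - X ^ 2) * (derivative u + C (Complex.I * ω) * u) - C ((n : ℂ) + 2) * (X * u) =
      C (-(Complex.I * ω)) * v + C e * u) : e = -d := by
  have hv'd : (derivative v).natDegree ≤ n + 1 := (natDegree_derivative_le v).trans (by omega)
  have hu'd : (derivative u).natDegree ≤ n := (natDegree_derivative_le u).trans (by omega)
  have hκ : momentFunctional ω (u * derivative v) ≠ 0 := by
    rw [hu.apply_mul hv'd, coeff_derivative]
    refine mul_ne_zero (mul_ne_zero ?_ ?_) (hu.apply_X_pow_ne_zero hu0 hud)
    · rw [show n + 1 + 1 = v.natDegree by omega, hvm.coeff_natDegree]; exact one_ne_zero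
    · exact_mod_cast (by omega : n + 1 + 1 ≠ 0)
  have h1 := momentFunctional_derivative_add ω ((1 - X ^ 2) * (u * derivative v))
  have hF' := congrArg derivative hF
  have h2 : derivative ((1 - X ^ 2) * (u * derivative v)) +
      C (Complex.I * ω) * ((1 - X ^ 2) * (u * derivative v)) =
      C (-(Complex.I * ω)) * (v * derivative v) + C (e + d) * (u * derivative v) +
        C c * (u * derivative u) - C ((n : ℂ) + 2) * (v * u) := by
    simp only [derivative_mul, derivative_add, derivative_C, derivative_X, zero_mul, zero_add,
      one_mul, C_add] at *
    linear_combination derivative v * hG + u * hF'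
  rw [h2, map_sub, map_add, map_add] at h1
  simp only [momentFunctional_C_mul] at h1
  rw [hv _ (hv'd.trans (by omega)), hu _ hu'd, hv u (by omega)] at h1
  have h3 : (e + d) * momentFunctional ω (u * derivative v) = 0 := by simpa using h1
  exact eq_neg_of_add_eq_zero_left ((mul_eq_zero.mp h3).resolve_right hκ)

end KissingPolynomials

theorem mainTheorem5 :
    ¬ ∃ (n : ℕ) (ω : ℝ), 0 < ω ∧
      KissingPolynomials.hankelDet n ω = 0 ∧ KissingPolynomials.hankelDet (n + 2) ω = 0 := by
  open Polynomial KissingPolynomials in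
  rintro ⟨n, ω, hω, h0, h2⟩
  obtain ⟨u, hum, hud, hu⟩ := exists_monic_isOrthogonal_of_hankelDet_eq_zero h0
  obtain ⟨v, hvm, hvd, hv⟩ := exists_monic_isOrthogonal_of_hankelDet_eq_zero h2
  obtain ⟨c, d, hF⟩ := exists_lower_eq hu hum hud hv hvm hvd
  obtain ⟨e, hG⟩ := exists_raise_eq hu hum hud hv hvm hvd
  obtain rfl := raise_coeff_eq_neg_lower_coeff hu hum.ne_zero hud.le hv hvm hvd hF hG
  have hω' : (ω : ℂ) ≠ 0 := by exact_mod_cast hω.ne'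
  have hκ : momentFunctional ω (u * (X * u)) ≠ 0 := by
    rw [hu.apply_mul ((natDegree_mul_le_of_le natDegree_X_le hud.le).trans (by omega)),
      coeff_X_mul]
    nth_rw 1 [← hud]
    rw [hum.coeff_natDegree, one_mul]
    exact hu.apply_X_pow_ne_zero hum.ne_zero hud.le
  have hu1 : u.eval 1 ≠ 0 := fun h => by
    have := hu.eval_one hud.le
    simp [h, hκ, hω'] at this
  have hu2 : u.eval (-1) ≠ 0 := fun h => by
    have := hu.eval_neg_one hud.le
    simp [h, hκ, hω'] at this
  have hF1 := congrArg (eval 1) hF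
  have hF2 := congrArg (eval (-1)) hF
  have hG1 := congrArg (eval 1) hG
  have hG2 := congrArg (eval (-1)) hG
  simp at hF1 hF2 hG1 hG2
  -- At x = 1 the relations read (n + 2 - d)v = cu and iωv = (n + 2 - d)u; eliminate v(1).
  have hc1 : ((n : ℂ) + 2 - d) ^ 2 = Complex.I * ω * c := by
    apply mul_right_cancel₀ hu1
    linear_combination Complex.I * ω * hF1 + (-(n + 2 - d)) * hG1
  have hc2 : ((n : ℂ) + 2 + d) ^ 2 = Complex.I * ω * c := by
    apply mul_right_cancel₀ hu2
    linear_combination Complex.I * ω * hF2 + (n + 2 + d) * hG2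
  have hn : (n : ℂ) + 2 ≠ 0 := by exact_mod_cast (by omega : n + 2 ≠ 0)
  obtain rfl : d = 0 := by
    apply mul_left_cancel₀ hn
    linear_combination (hc2 - hc1) / 4
  simp only [neg_zero, C_0, zero_mul, add_zero] at hF hG hc1
  -- Differentiate the lowering relation and eliminate u by both relations, using iωc = (n + 2)².
  have hT : heunOperator (n + 2) ω v = 0 := by
    apply mul_left_cancel₀ one_sub_X_sq_ne_zero
    have hF' := congrArg derivative hF
    have hc := congrArg (C : ℂ → ℂ[X]) hc1
    rw [heunOperator_apply]
    simp only [derivative_mul, derivative_add, derivative_sub, derivative_one, derivative_C,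
      derivative_X, derivative_X_pow, derivative_natCast, derivative_ofNat, C_add, C_sub, C_mul,
      C_neg, C_0, C_pow, map_natCast, map_ofNat, Nat.cast_add, Nat.cast_ofNat, C_1] at *
    linear_combination (1 - X ^ 2) * hF' + ((1 - X ^ 2) * C Complex.I * C (ω : ℂ)
      - ((n : ℂ[X]) + 2) * X) * hF + C c * hG + v * hc
  exact hvm.ne_zero (eq_zero_of_heunOperator_eq_zero (by omega) hω hT)
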